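/- Let $n\in\mathbb{N}$, let $\Delta_n=\{p\in\mathbb{R}^n: p^j>0,\ \sum_j p^j=1\}$ be the open simplex with the Fisher–Rao metric $\mathrm{G}_{FR}=\sum_j \frac{1}{p^j}\,\mathrm{d}p^j\otimes \mathrm{d}p^j$, and let $\mathscr{C}_n=\{p\in\Delta_n: p^1<\dots<p^n\}$. For $p\in\Delta_n$ and $a\in\mathbb{R}^n$ with $\sum_j a^j=0$ put $\|a\|=\big(\sum_j (a^j)^2/p^j\big)^{1/2}$ and $$p_a^j(t)=\cos^2\!\Big(\tfrac{t}{2}\|a\|\Big)\,p^j+\frac{\sin^2\!\big(\tfrac t2\|a\|\big)}{\|a\|^2}\,\frac{a^ja^j}{p^j}+\frac{\sin(t\|a\|)}{\|a\|}\,a^j ,$$ with $p_a(t)=p$ for all $t$ if $a=0$. Let $\mathscr{S}_{md}$ be the manifold of positive definite complex $n\times n$ matrices of trace one with $n$ distinct eigenvalues, with tangent space at each point the traceless Hermitian matrices. For a function $f:(0,\infty)\to(0,\infty)$ that is operator monotone with $f(x)=x f(x^{-1})$ and $f(1)=1$, let $\mathrm{G}_f$ be the monotone metric $(\mathrm{G}_f)_\rho(v,w)=\mathrm{Tr}\big(v^\dagger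 (K^f_\rho)^{-1}(w)\big)$, where $K_\rho^f=f(L_\rho R_{\rho^{-1}})R_\rho$, $L_\rho(x)=\rho x$, $R_\rho(x)=x\rho$. (1) For $p\in\Delta_n$ and $a$ as above, let $J$ be the largest interval containing $0$ on which $p_a(t)\in\Delta_n$. Then $J$ is open, $p_a(0)=p$, $p_a'(0)=a$, and $p_a$ is a geodesic of $(\Delta_n,\mathrm{G}_{FR})$ on $J$. Every geodesic of $(\Delta_n,\mathrm{G}_{FR})$ that is defined on an open interval $I\ni 0$ and has initial point $p$ and initial velocity $a$ satisfies $I\subseteq J$ and equals $p_a$ on $I$. (2) For $p\in\mathscr{C}_n$, $a$ as above and $U\in SU(n)$, let $J$ be the largest interval containing $0$ on which $p_a(t)\in\mathscr{C}_n$. Then $J$ is open, and for every $f$ as above the curve $$t\longmapsto U\,\mathrm{diag}\big(p_a^1(t),\dots,p_a^n(t)\big)\,U^\dagger,\qquad t\in J,$$ is a geodesic of $(\mathscr{S}_{md},\mathrm{G}_f)$. Here a geodesic is a curve with $\nabla_{\gamma'}\gamma'=0$ for the Levi-Civita connection. -/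

import Mathlib

open scoped ComplexOrder

noncomputable section

namespace UniversalGeodesics

/-! ## Geodesics of a Riemannian metric on an open piece of an affine space

The manifold `S` is an open subset of an affine subspace of `E` whose direction is `V`, so every
tangent space is identified with `V`, and `g ρ u v` is the metric at `ρ ∈ S`. -/

section Geodesic

variable {E : Type*} [AddCommGroup E] [Module ℝ E] [TopologicalSpace E]

/-- The function `s ↦ g_{ρ + s x}(y, z)`. -/
def alongLine (g : E → E → E → ℝ) (ρ x y z : E) : ℝ → ℝ :=
  fun s => g (ρ + s • x) y z

/-- The directional derivative `(D_x g)_ρ(y, z)` of the metric coefficients. -/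
def metricDeriv (g : E → E → E → ℝ) (ρ x y z : E) : ℝ :=
  deriv (alongLine g ρ x y z) 0

/-- Christoffel symbols of the first kind (Koszul formula for the constant fields `x, y, z`). -/
def christoffel (g : E → E → E → ℝ) (ρ x y z : E) : ℝ :=
  (metricDeriv g ρ x y z + metricDeriv g ρ y x z - metricDeriv g ρ z x y) / 2

/-- `γ` is, on the open set `I` of times, an affinely parametrized geodesic of `(S, g)`: it is a
twice differentiable curve in `S` and `∇_{γ'} γ' = 0` for the Levi-Civita connection, that is
`g_γ(γ'', w) + Γ_γ(γ', γ'; w) = 0` for every tangent vector `w`. The derivatives of `g` that enter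
are required to exist. -/
def IsGeodesicOn (S V : Set E) (g : E → E → E → ℝ) (I : Set ℝ) (γ : ℝ → E) : Prop :=
  (∀ t ∈ I, γ t ∈ S ∧ DifferentiableAt ℝ γ t ∧ DifferentiableAt ℝ (deriv γ) t) ∧
  ∀ t ∈ I, ∀ w ∈ V,
    DifferentiableAt ℝ (alongLine g (γ t) (deriv γ t) (deriv γ t) w) 0 ∧
    DifferentiableAt ℝ (alongLine g (γ t) w (deriv γ t) (deriv γ t)) 0 ∧
    g (γ t) (deriv (deriv γ) t) w + christoffel g (γ t) (deriv γ t) (deriv γ t) w = 0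

end Geodesic

/-! ## The simplex and the Fisher-Rao metric -/

/-- The open simplex. -/
def simplex (n : ℕ) : Set (Fin n → ℝ) := {p | (∀ j, 0 < p j) ∧ ∑ j, p j = 1}

/-- The tangent space of the simplex. -/
def simplexTangent (n : ℕ) : Set (Fin n → ℝ) := {a | ∑ j, a j = 0}

/-- The Weyl chamber `p₁ < p₂ < ⋯ < pₙ` of the open simplex. -/
def weylChamber (n : ℕ) : Set (Fin n → ℝ) := {p | p ∈ simplex n ∧ StrictMono p}

/-- The Fisher-Rao metric `∑ⱼ dpʲ ⊗ dpʲ / pʲ`. -/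
def fisherRao {n : ℕ} (p a b : Fin n → ℝ) : ℝ := ∑ j, a j * b j / p j

/-- The Fisher-Rao norm of a tangent vector `a` at `p`. -/
def frNorm {n : ℕ} (p a : Fin n → ℝ) : ℝ := √(fisherRao p a a)

/-- The explicit curve with initial point `p` and initial velocity `a`; for `a = 0` the conventions
for division by zero make it the constant curve `p`. -/
def frCurve {n : ℕ} (p a : Fin n → ℝ) (t : ℝ) : Fin n → ℝ := fun j =>
  Real.cos (t / 2 * frNorm p a) ^ 2 * p j
    + Real.sin (t / 2 * frNorm p a) ^ 2 / frNorm p a ^ 2 * (a j * a j / p j)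
    + Real.sin (t * frNorm p a) / frNorm p a * a j

/-! ## States and monotone metrics -/

/-- Faithful states with non-degenerate spectrum: positive definite, of unit trace, all eigenvalues
simple. -/
def nondegenerateStates (n : ℕ) : Set (Matrix (Fin n) (Fin n) ℂ) :=
  {ρ | ρ.PosDef ∧ ρ.trace = 1 ∧ ρ.charpoly.roots.Nodup}

/-- The tangent space of the manifold of faithful states: traceless Hermitian matrices. -/
def stateTangent (n : ℕ) : Set (Matrix (Fin n) (Fin n) ℂ) :=
  {v | v.IsHermitian ∧ v.trace = 0}

/-- `f` is operator monotone on `(0, ∞)`. -/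
def OperatorMonotone (f : ℝ → ℝ) : Prop :=
  ∀ (k : ℕ) (A B : Matrix (Fin k) (Fin k) ℂ), A.PosDef → B.PosDef →
    (B - A).PosSemidef → (cfc f B - cfc f A).PosSemidef

/-- The functions on `(0, ∞)` that label the monotone metrics (values elsewhere play no role). -/
structure IsPetzFunction (f : ℝ → ℝ) : Prop where
  pos : ∀ x, 0 < x → 0 < f x
  operatorMonotone : OperatorMonotone f
  symm : ∀ x, 0 < x → f x = x * f x⁻¹
  map_one : f 1 = 1

/-- A super-operator on `n × n` matrices. -/
abbrev SuperOp (n : ℕ) := Module.End ℂ (Matrix (Fin n) (Fin n) ℂ)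

/-- Functional calculus `f(Φ)` of a super-operator that is self-adjoint for the Hilbert-Schmidt
product, computed in the matrix units, which are a Hilbert-Schmidt orthonormal basis. -/
def superFun {n : ℕ} (f : ℝ → ℝ) (Φ : SuperOp n) : SuperOp n :=
  Matrix.toLin (Matrix.stdBasis ℂ (Fin n) (Fin n)) (Matrix.stdBasis ℂ (Fin n) (Fin n))
    (cfc f (LinearMap.toMatrix (Matrix.stdBasis ℂ (Fin n) (Fin n))
      (Matrix.stdBasis ℂ (Fin n) (Fin n)) Φ))

/-- `K_ρ = f(L_ρ R_{ρ⁻¹}) R_ρ`, where `L_ρ a = ρ a` and `R_ρ a = a ρ`. -/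
def petzK {n : ℕ} (f : ℝ → ℝ) (ρ : Matrix (Fin n) (Fin n) ℂ) : SuperOp n :=
  superFun f (LinearMap.mulLeft ℂ ρ ∘ₗ LinearMap.mulRight ℂ ρ⁻¹) ∘ₗ LinearMap.mulRight ℂ ρ

/-- The monotone metric `(G_f)_ρ(v, w) = Tr(v† K_ρ⁻¹ w)`, which is real on Hermitian `v, w`. -/
def monotoneMetric {n : ℕ} (f : ℝ → ℝ) (ρ v w : Matrix (Fin n) (Fin n) ℂ) : ℝ :=
  (Matrix.trace (v.conjTranspose * (Ring.inverse (petzK f ρ)) w)).re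

/-- The unfolding map `π(U, p) = U diag(p) U†`. -/
def unfolding {n : ℕ} (U : Matrix.specialUnitaryGroup (Fin n) ℂ) (p : Fin n → ℝ) :
    Matrix (Fin n) (Fin n) ℂ :=
  (U : Matrix (Fin n) (Fin n) ℂ) * Matrix.diagonal (fun j => (p j : ℂ))
    * (U : Matrix (Fin n) (Fin n) ℂ).conjTranspose

/-- The largest interval of times around `0` during which the curve `c` stays in `S`. -/
def lifetime {X : Type*} (S : Set X) (c : ℝ → X) : Set ℝ := connectedComponentIn (c ⁻¹' S) 0

end UniversalGeodesics

end

/-!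
The substitution `pʲ = (yʲ)²` turns the Fisher–Rao metric into four times the round metric of the
unit sphere: along a geodesic of (constant) speed `r`, every `√pʲ` satisfies `y'' = -(r / 2)² y`,
and squaring the solution gives `frCurve`.

For the matrix curves, the Koszul formula involves the derivative of `G_f(x, x)` in directions `w`
that do not commute with `ρ`. Being symmetric, normalized and operator monotone, `f` lies between
`2 x / (1 + x)` and `(1 + x) / 2`, whence for all Hermitian `x` and `y`
`2 Re Tr(y x) - Re Tr(ρ y²) ≤ G_f(x, x) ≤ Re Tr(ρ⁻¹ x²)`.
If `x` commutes with `ρ` and `y = ρ⁻¹ x`, the two bounds agree to first order at `ρ`, and so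
`D_w G_f(x, x) = -Re Tr(ρ⁻¹ w ρ⁻¹ x²)` for every `f`. Hence the geodesic equation of `G_f` along
`U diag(q) U†`, tested against `w`, is the Fisher–Rao geodesic equation of `q` tested against the
diagonal of `U† w U`.
-/

noncomputable section

namespace UniversalGeodesics

section Geodesic

variable {E : Type*} [AddCommGroup E] [Module ℝ E] [TopologicalSpace E] {S V : Set E}
  {g : E → E → E → ℝ} {I : Set ℝ} {γ : ℝ → E} {t : ℝ}

theorem IsGeodesicOn.mem (hγ : IsGeodesicOn S V g I γ) (ht : t ∈ I) : γ t ∈ S := (hγ.1 t ht).1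

theorem IsGeodesicOn.differentiableAt (hγ : IsGeodesicOn S V g I γ) (ht : t ∈ I) :
    DifferentiableAt ℝ γ t :=
  (hγ.1 t ht).2.1

theorem IsGeodesicOn.differentiableAt_deriv (hγ : IsGeodesicOn S V g I γ) (ht : t ∈ I) :
    DifferentiableAt ℝ (deriv γ) t :=
  (hγ.1 t ht).2.2

end Geodesic

section Oscillation

theorem eq_of_hasDerivAt_zero {I : Set ℝ} (hI : IsOpen I) (hI' : IsPreconnected I) {F : ℝ → ℝ}
    (hF : ∀ t ∈ I, HasDerivAt F 0 t) {s t : ℝ} (hs : s ∈ I) (ht : t ∈ I) : F s = F t :=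
  hI.is_const_of_deriv_eq_zero hI'
    (fun u hu => (hF u hu).differentiableAt.differentiableWithinAt)
    (fun u hu => (hF u hu).deriv) hs ht

/-- The solution of `z'' = -ω² z` with `z 0 = y` and `z' 0 = v`. For `ω = 0` division by zero makes
it the constant `y`, which is the solution only if `v = 0`. -/
def oscillation (ω y v t : ℝ) : ℝ := Real.cos (ω * t) * y + Real.sin (ω * t) / ω * v

theorem oscillation_zero (ω y v : ℝ) : oscillation ω y v 0 = y := by simp [oscillation]

theorem hasDerivAt_oscillation {ω v : ℝ} (h : ω = 0 → v = 0) (y t : ℝ) :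
    HasDerivAt (oscillation ω y v) (oscillation ω v (-(ω ^ 2 * y)) t) t := by
  have harg : HasDerivAt (fun s => ω * s) ω t := by
    simpa using (hasDerivAt_id t).const_mul ω
  refine ((harg.cos.mul_const y).add ((harg.sin.div_const ω).mul_const v)).congr_deriv ?_
  rw [oscillation]
  by_cases hω : ω = 0
  · simp [hω, h hω]
  · field_simp
    ring

theorem oscillation_neg_sq_mul (ω y v t : ℝ) :
    oscillation ω (-(ω ^ 2 * y)) (-(ω ^ 2 * v)) t = -(ω ^ 2 * oscillation ω y v t) := by
  simp only [oscillation]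
  ring

variable {I : Set ℝ} {z v : ℝ → ℝ} {ω t₀ : ℝ}

/-- The energy `v² + ω² z²` is conserved. -/
theorem eq_zero_of_hasDerivAt_neg_sq_mul (hI : IsOpen I) (hI' : IsPreconnected I) (ht₀ : t₀ ∈ I)
    (hz : ∀ t ∈ I, HasDerivAt z (v t) t) (hv : ∀ t ∈ I, HasDerivAt v (-(ω ^ 2 * z t)) t)
    (z₀ : z t₀ = 0) (v₀ : v t₀ = 0) {t : ℝ} (ht : t ∈ I) : z t = 0 := by
  have energy (s) (hs : s ∈ I) : v s ^ 2 + ω ^ 2 * z s ^ 2 = 0 := by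
    have := eq_of_hasDerivAt_zero hI hI' (F := fun t => v t ^ 2 + ω ^ 2 * z t ^ 2)
      (fun u hu => (((hv u hu).pow 2).add (((hz u hu).pow 2).const_mul (ω ^ 2))).congr_deriv
        (by simp only [Nat.cast_ofNat, Nat.add_one_sub_one, pow_one]; ring)) hs ht₀
    simpa [z₀, v₀] using this
  have hv0 (s) (hs : s ∈ I) : v s = 0 := by
    have := energy s hs
    exact pow_eq_zero_iff two_ne_zero |>.1 (by nlinarith [sq_nonneg (v s), sq_nonneg (ω * z s)])
  rw [← z₀]
  exact eq_of_hasDerivAt_zero hI hI' (fun s hs => (hz s hs).congr_deriv (hv0 s hs)) ht ht₀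

theorem eq_oscillation (hI : IsOpen I) (hI' : IsPreconnected I) (h0 : 0 ∈ I)
    (hz : ∀ t ∈ I, HasDerivAt z (v t) t) (hv : ∀ t ∈ I, HasDerivAt v (-(ω ^ 2 * z t)) t)
    (hω : ω = 0 → v 0 = 0) {t : ℝ} (ht : t ∈ I) : z t = oscillation ω (z 0) (v 0) t := by
  refine sub_eq_zero.1 (eq_zero_of_hasDerivAt_neg_sq_mul
    (z := fun t => z t - oscillation ω (z 0) (v 0) t)
    (v := fun t => v t - oscillation ω (v 0) (-(ω ^ 2 * z 0)) t) (ω := ω) hI hI' h0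
    (fun s hs => (hz s hs).sub (hasDerivAt_oscillation hω _ s)) (fun s hs => ?_)
    (by simp [oscillation_zero]) (by simp [oscillation_zero]) ht)
  refine ((hv s hs).sub (hasDerivAt_oscillation (by simp +contextual) _ s)).congr_deriv ?_
  rw [oscillation_neg_sq_mul]
  ring

end Oscillation

section FisherRao

variable {n : ℕ} {p : Fin n → ℝ}

theorem fisherRao_comm (p u w : Fin n → ℝ) : fisherRao p u w = fisherRao p w u := by
  simp only [fisherRao, mul_comm]

theorem fisherRao_smul_left (p u w : Fin n → ℝ) (c : ℝ) :
    fisherRao p (c • u) w = c * fisherRao p u w := by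
  simp only [fisherRao, Finset.mul_sum, Pi.smul_apply, smul_eq_mul, mul_assoc, mul_div_assoc]

theorem fisherRao_sub_right (p u w w' : Fin n → ℝ) :
    fisherRao p u (w - w') = fisherRao p u w - fisherRao p u w' := by
  simp only [fisherRao, ← Finset.sum_sub_distrib, Pi.sub_apply, mul_sub, sub_div]

theorem fisherRao_single_right (p u : Fin n → ℝ) (j : Fin n) :
    fisherRao p u (Pi.single j 1) = u j / p j := by
  simp [fisherRao, Pi.single_apply, ite_div]

theorem fisherRao_self_right (hp : ∀ j, p j ≠ 0) (u : Fin n → ℝ) :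
    fisherRao p u p = ∑ j, u j := by
  simp only [fisherRao, mul_div_cancel_right₀ _ (hp _)]

theorem fisherRao_self_nonneg (hp : ∀ j, 0 ≤ p j) (a : Fin n → ℝ) : 0 ≤ fisherRao p a a :=
  Finset.sum_nonneg fun j _ => div_nonneg (mul_self_nonneg _) (hp j)

theorem forall_fisherRao_eq_zero_iff (hp : p ∈ simplex n) {u : Fin n → ℝ} :
    (∀ w ∈ simplexTangent n, fisherRao p u w = 0) ↔ u = (∑ j, u j) • p := by
  have hne (j) : p j ≠ 0 := (hp.1 j).ne'
  constructor
  · intro h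
    ext j
    have := h (Pi.single j 1 - p) (by simp [simplexTangent, hp.2])
    rw [fisherRao_sub_right, fisherRao_single_right, fisherRao_self_right hne, sub_eq_zero,
      div_eq_iff (hne j)] at this
    exact this
  · intro h w (hw : ∑ j, w j = 0)
    rw [h, fisherRao_smul_left, fisherRao_comm, fisherRao_self_right hne, hw, mul_zero]

theorem frNorm_sq (hp : ∀ j, 0 ≤ p j) (a : Fin n → ℝ) : frNorm p a ^ 2 = fisherRao p a a :=
  Real.sq_sqrt (fisherRao_self_nonneg hp a)

theorem eq_zero_of_frNorm_eq_zero (hp : ∀ j, 0 < p j) {a : Fin n → ℝ} (h : frNorm p a = 0) :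
    a = 0 := by
  have hsum : ∑ j, a j * a j / p j = 0 := by
    change fisherRao p a a = 0
    rw [← frNorm_sq fun j => (hp j).le, h, zero_pow two_ne_zero]
  ext j
  have := (Finset.sum_eq_zero_iff_of_nonneg
    fun j _ => div_nonneg (mul_self_nonneg (a j)) (hp j).le).1 hsum j (Finset.mem_univ j)
  simpa [(hp j).ne'] using this

theorem hasDerivAt_alongLine_fisherRao (hp : ∀ j, p j ≠ 0) (x y z : Fin n → ℝ) :
    HasDerivAt (alongLine fisherRao p x y z) (-∑ j, x j * y j * z j / p j ^ 2) 0 := by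
  rw [← Finset.sum_neg_distrib]
  change HasDerivAt (fun s : ℝ => ∑ j, y j * z j / (p j + s * x j)) _ 0
  refine HasDerivAt.fun_sum fun j _ => ?_
  have hline : HasDerivAt (fun s : ℝ => p j + s * x j) (x j) 0 := by
    simpa using ((hasDerivAt_id (0 : ℝ)).mul_const (x j)).const_add (p j)
  refine ((hasDerivAt_const (0 : ℝ) (y j * z j)).div hline (by simpa using hp j)).congr_deriv ?_
  simp only [zero_mul, add_zero, zero_sub]
  ring

/-- The covariant derivative of the velocity along a curve with position `p`, velocity `x` and
second derivative `u`, for the metric `∑ⱼ dpʲ ⊗ dpʲ / pʲ` of the positive orthant. -/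
def covariantAccel (p x u : Fin n → ℝ) : Fin n → ℝ := fun j => u j - x j ^ 2 / (2 * p j)

theorem fisherRao_add_christoffel (hp : ∀ j, p j ≠ 0) (u x w : Fin n → ℝ) :
    fisherRao p u w + christoffel fisherRao p x x w = fisherRao p (covariantAccel p x u) w := by
  simp only [christoffel, metricDeriv, (hasDerivAt_alongLine_fisherRao hp _ _ _).deriv, fisherRao,
    ← Finset.sum_neg_distrib, ← Finset.sum_add_distrib, ← Finset.sum_sub_distrib, Finset.sum_div,
    covariantAccel]
  refine Finset.sum_congr rfl fun j _ => ?_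
  have := hp j
  field_simp
  ring

theorem sum_covariantAccel (p x u : Fin n → ℝ) :
    ∑ j, covariantAccel p x u j = ∑ j, u j - fisherRao p x x / 2 := by
  simp only [covariantAccel, Finset.sum_sub_distrib, fisherRao, Finset.sum_div]
  congr 1
  exact Finset.sum_congr rfl fun j _ => by ring

variable {I : Set ℝ} {q v : ℝ → Fin n → ℝ} {t : ℝ}

theorem isGeodesicOn_simplex_iff :
    IsGeodesicOn (simplex n) (simplexTangent n) fisherRao I q ↔
      (∀ t ∈ I, q t ∈ simplex n ∧ DifferentiableAt ℝ q t ∧ DifferentiableAt ℝ (deriv q) t) ∧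
      ∀ t ∈ I, covariantAccel (q t) (deriv q t) (deriv (deriv q) t)
        = (∑ j, covariantAccel (q t) (deriv q t) (deriv (deriv q) t) j) • q t := by
  refine and_congr_right fun h => forall₂_congr fun t ht => ?_
  have hne (j) : q t j ≠ 0 := ((h t ht).1.1 j).ne'
  simp only [← forall_fisherRao_eq_zero_iff (h t ht).1, fisherRao_add_christoffel hne,
    (hasDerivAt_alongLine_fisherRao hne _ _ _).differentiableAt, true_and]

theorem sum_deriv_eq_zero {k : ℝ} (hI : IsOpen I) (hq : ∀ t ∈ I, ∑ j, q t j = k) (ht : t ∈ I)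
    (hd : DifferentiableAt ℝ q t) : ∑ j, deriv q t j = 0 := by
  have hsum : HasDerivAt (fun s => ∑ j, q s j) (∑ j, deriv q t j) t :=
    HasDerivAt.fun_sum fun j _ => hasDerivAt_pi.1 hd.hasDerivAt j
  exact hsum.unique ((hasDerivAt_const t k).congr_of_eventuallyEq
    (Filter.eventually_of_mem (hI.mem_nhds ht) hq))

theorem hasDerivAt_fisherRao_self {v' : Fin n → ℝ} (hpos : ∀ j, q t j ≠ 0)
    (hq : HasDerivAt q (v t) t) (hv : HasDerivAt v v' t) :
    HasDerivAt (fun s => fisherRao (q s) (v s) (v s))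
      (2 * fisherRao (q t) (covariantAccel (q t) (v t) v') (v t)) t := by
  have hvj := hasDerivAt_pi.1 hv
  refine (HasDerivAt.fun_sum fun j _ => ((hvj j).mul (hvj j)).div (hasDerivAt_pi.1 hq j)
    (hpos j)).congr_deriv ?_
  simp only [fisherRao, covariantAccel, Finset.mul_sum, Pi.mul_apply]
  refine Finset.sum_congr rfl fun j _ => ?_
  have := hpos j
  field_simp
  ring

namespace IsGeodesicOn

variable (hq : IsGeodesicOn (simplex n) (simplexTangent n) fisherRao I q)

include hq

theorem deriv_mem_simplexTangent (hI : IsOpen I) (ht : t ∈ I) : deriv q t ∈ simplexTangent n :=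
  sum_deriv_eq_zero hI (fun _ hs => (hq.mem hs).2) ht (hq.differentiableAt ht)

theorem covariantAccel_eq (hI : IsOpen I) (ht : t ∈ I) :
    covariantAccel (q t) (deriv q t) (deriv (deriv q) t)
      = -(fisherRao (q t) (deriv q t) (deriv q t) / 2) • q t := by
  have hsum : ∑ j, deriv (deriv q) t j = 0 :=
    sum_deriv_eq_zero hI (fun _ hs => hq.deriv_mem_simplexTangent hI hs) ht
      (hq.differentiableAt_deriv ht)
  rw [(isGeodesicOn_simplex_iff.1 hq).2 t ht, sum_covariantAccel, hsum, zero_sub]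

theorem speed_eq (hI : IsOpen I) (hI' : IsPreconnected I) {s : ℝ} (hs : s ∈ I) (ht : t ∈ I) :
    fisherRao (q s) (deriv q s) (deriv q s) = fisherRao (q t) (deriv q t) (deriv q t) := by
  refine eq_of_hasDerivAt_zero hI hI' (F := fun t => fisherRao (q t) (deriv q t) (deriv q t))
    (fun u hu => ?_) hs ht
  refine (hasDerivAt_fisherRao_self (fun j => ((hq.mem hu).1 j).ne')
    (hq.differentiableAt hu).hasDerivAt (hq.differentiableAt_deriv hu).hasDerivAt).congr_deriv ?_
  rw [(forall_fisherRao_eq_zero_iff (hq.mem hu)).2 ((isGeodesicOn_simplex_iff.1 hq).2 u hu)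
    _ (hq.deriv_mem_simplexTangent hI hu), mul_zero]

theorem hasDerivAt_sqrt (ht : t ∈ I) (j : Fin n) :
    HasDerivAt (fun s => √(q s j)) (deriv q t j / (2 * √(q t j))) t :=
  (hasDerivAt_pi.1 ((hq.differentiableAt ht).hasDerivAt) j).sqrt ((hq.mem ht).1 j).ne'

theorem hasDerivAt_deriv_sqrt (hI : IsOpen I) (ht : t ∈ I) (j : Fin n) :
    HasDerivAt (fun s => deriv q s j / (2 * √(q s j)))
      (-((frNorm (q t) (deriv q t) / 2) ^ 2 * √(q t j))) t := by
  have hpos := (hq.mem ht).1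
  have hs : 0 < √(q t j) := Real.sqrt_pos.2 (hpos j)
  have hsq : q t j = √(q t j) ^ 2 := (Real.sq_sqrt (hpos j).le).symm
  have haccel := congrFun (hq.covariantAccel_eq hI ht) j
  rw [← frNorm_sq fun i => (hpos i).le, covariantAccel, Pi.smul_apply, smul_eq_mul,
    sub_eq_iff_eq_add] at haccel
  have hvel := hasDerivAt_pi.1 (hq.differentiableAt_deriv ht).hasDerivAt j
  refine (hvel.div ((hq.hasDerivAt_sqrt ht j).const_mul 2) (by positivity)).congr_deriv ?_
  rw [haccel]
  generalize √(q t j) = y at *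
  rw [hsq]
  field_simp
  ring

end IsGeodesicOn

variable {a : Fin n → ℝ}

theorem frCurve_eq_oscillation_sq (hp : ∀ j, 0 < p j) (a : Fin n → ℝ) (t : ℝ) (j : Fin n) :
    frCurve p a t j = oscillation (frNorm p a / 2) √(p j) (a j / (2 * √(p j))) t ^ 2 := by
  have hs : 0 < √(p j) := Real.sqrt_pos.2 (hp j)
  have hsq : p j = √(p j) ^ 2 := (Real.sq_sqrt (hp j).le).symm
  have harg : t * frNorm p a = 2 * (t / 2 * frNorm p a) := by ring
  have harg' : frNorm p a / 2 * t = t / 2 * frNorm p a := by ring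
  rw [frCurve, oscillation, harg, harg', Real.sin_two_mul]
  generalize t / 2 * frNorm p a = θ
  generalize √(p j) = y at *
  rw [hsq]
  field_simp
  ring

theorem div_sqrt_eq_zero_of_frNorm_div_eq_zero (hp : ∀ j, 0 < p j) (j : Fin n)
    (h : frNorm p a / 2 = 0) : a j / (2 * √(p j)) = 0 := by
  simp [eq_zero_of_frNorm_eq_zero hp (a := a) (by linarith)]

theorem IsGeodesicOn.eq_frCurve (hI : IsOpen I) (hI' : IsPreconnected I) (h0 : 0 ∈ I)
    (hq : IsGeodesicOn (simplex n) (simplexTangent n) fisherRao I q) (ht : t ∈ I) :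
    q t = frCurve (q 0) (deriv q 0) t := by
  have hpos := (hq.mem h0).1
  have hspeed (s) (hs : s ∈ I) : frNorm (q s) (deriv q s) = frNorm (q 0) (deriv q 0) :=
    congrArg Real.sqrt (hq.speed_eq hI hI' hs h0)
  ext j
  have hosc := eq_oscillation hI hI' h0 (fun s hs => hq.hasDerivAt_sqrt hs j)
    (fun s hs => hspeed s hs ▸ hq.hasDerivAt_deriv_sqrt hI hs j)
    (div_sqrt_eq_zero_of_frNorm_div_eq_zero hpos j) ht
  rw [frCurve_eq_oscillation_sq hpos, ← hosc, Real.sq_sqrt ((hq.mem ht).1 j).le]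

theorem frCurve_zero (p a : Fin n → ℝ) : frCurve p a 0 = p := by
  ext j
  simp [frCurve]

theorem sum_frCurve (hp : p ∈ simplex n) (ha : a ∈ simplexTangent n) (t : ℝ) :
    ∑ j, frCurve p a t j = 1 := by
  have hnorm : ∑ j, a j * a j / p j = frNorm p a ^ 2 := (frNorm_sq (fun j => (hp.1 j).le) a).symm
  have ha' : ∑ j, a j = 0 := ha
  simp only [frCurve, Finset.sum_add_distrib, ← Finset.mul_sum, hnorm, ha', hp.2]
  by_cases hr : frNorm p a = 0
  · simp [hr]
  · field_simp
    simp [add_comm]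

/-- The velocity of `frCurve p a`, as the derivative of the square of an `oscillation`. -/
def frVelocity (p a : Fin n → ℝ) (t : ℝ) : Fin n → ℝ := fun j =>
  2 * oscillation (frNorm p a / 2) √(p j) (a j / (2 * √(p j))) t
    * oscillation (frNorm p a / 2) (a j / (2 * √(p j))) (-((frNorm p a / 2) ^ 2 * √(p j))) t

theorem hasDerivAt_frCurve (hp : ∀ j, 0 < p j) (a : Fin n → ℝ) (t : ℝ) :
    HasDerivAt (frCurve p a) (frVelocity p a t) t := by
  refine hasDerivAt_pi.2 fun j => ?_
  simp only [frCurve_eq_oscillation_sq hp]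
  refine ((hasDerivAt_oscillation (div_sqrt_eq_zero_of_frNorm_div_eq_zero hp j) _ t).pow
    2).congr_deriv ?_
  simp [frVelocity]

theorem continuous_frCurve (hp : ∀ j, 0 < p j) (a : Fin n → ℝ) : Continuous (frCurve p a) :=
  continuous_iff_continuousAt.2 fun t => (hasDerivAt_frCurve hp a t).continuousAt

theorem frVelocity_zero (hp : ∀ j, 0 < p j) (a : Fin n → ℝ) : frVelocity p a 0 = a := by
  ext j
  have := Real.sqrt_pos.2 (hp j)
  simp only [frVelocity, oscillation_zero]
  field_simp

theorem hasDerivAt_frVelocity (hp : ∀ j, 0 < p j) (a : Fin n → ℝ) {t : ℝ}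
    (hpos : ∀ j, frCurve p a t j ≠ 0) :
    HasDerivAt (frVelocity p a)
      (fun j => frVelocity p a t j ^ 2 / (2 * frCurve p a t j)
        - frNorm p a ^ 2 / 2 * frCurve p a t j) t := by
  refine hasDerivAt_pi.2 fun j => ?_
  refine (((hasDerivAt_oscillation (div_sqrt_eq_zero_of_frNorm_div_eq_zero hp j) _ t).const_mul
    2).mul (hasDerivAt_oscillation (by simp +contextual) _ t)).congr_deriv ?_
  have := hpos j
  rw [oscillation_neg_sq_mul]
  rw [frCurve_eq_oscillation_sq hp] at this ⊢
  have := pow_ne_zero_iff two_ne_zero |>.1 this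
  simp only [frVelocity]
  field_simp
  ring

theorem isGeodesicOn_frCurve (hp : ∀ j, 0 < p j) (hI : ∀ t ∈ I, frCurve p a t ∈ simplex n) :
    IsGeodesicOn (simplex n) (simplexTangent n) fisherRao I (frCurve p a) := by
  have hderiv : deriv (frCurve p a) = frVelocity p a :=
    funext fun t => (hasDerivAt_frCurve hp a t).deriv
  have hderiv₂ (t) (ht : t ∈ I) :=
    hasDerivAt_frVelocity hp a fun j => ((hI t ht).1 j).ne'
  refine isGeodesicOn_simplex_iff.2 ⟨fun t ht => ⟨hI t ht,
    (hasDerivAt_frCurve hp a t).differentiableAt, hderiv ▸ (hderiv₂ t ht).differentiableAt⟩,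
    fun t ht => ?_⟩
  have haccel : covariantAccel (frCurve p a t) (deriv (frCurve p a) t)
      (deriv (deriv (frCurve p a)) t) = -(frNorm p a ^ 2 / 2) • frCurve p a t := by
    ext j
    rw [hderiv, (hderiv₂ t ht).deriv]
    simp [covariantAccel]
  simp [haccel, ← Finset.mul_sum, (hI t ht).2]

end FisherRao

section Lifetime

variable {X : Type*} {S : Set X} {c : ℝ → X}

theorem zero_mem_lifetime (h : c 0 ∈ S) : 0 ∈ lifetime S c := mem_connectedComponentIn h

theorem mapsTo_lifetime (S : Set X) (c : ℝ → X) : Set.MapsTo c (lifetime S c) S :=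
  connectedComponentIn_subset _ _

theorem subset_lifetime {I : Set ℝ} (hI : IsPreconnected I) (h0 : 0 ∈ I) (h : Set.MapsTo c I S) :
    I ⊆ lifetime S c :=
  hI.subset_connectedComponentIn h0 h

theorem isOpen_lifetime (h : IsOpen (c ⁻¹' S)) : IsOpen (lifetime S c) := h.connectedComponentIn

variable {n : ℕ} {q : ℝ → Fin n → ℝ}

theorem isOpen_preimage_simplex (hq : Continuous q) (hsum : ∀ t, ∑ j, q t j = 1) :
    IsOpen (q ⁻¹' simplex n) := by
  have h : q ⁻¹' simplex n = {t | ∀ j, 0 < q t j} := by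
    ext t
    simp [simplex, hsum]
  rw [h, Set.ofPred_forall]
  exact isOpen_iInter_of_finite fun j =>
    isOpen_lt continuous_const ((continuous_apply j).comp hq)

theorem isOpen_preimage_weylChamber (hq : Continuous q) (hsum : ∀ t, ∑ j, q t j = 1) :
    IsOpen (q ⁻¹' weylChamber n) := by
  have h : q ⁻¹' weylChamber n =
      q ⁻¹' simplex n ∩ ⋂ i, ⋂ j, ⋂ _ : i < j, {t | q t i < q t j} := by
    ext t
    simp [weylChamber, StrictMono]
  rw [h]
  refine (isOpen_preimage_simplex hq hsum).inter <| isOpen_iInter_of_finite fun i =>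
    isOpen_iInter_of_finite fun j => isOpen_iInter_of_finite fun _ => ?_
  exact isOpen_lt ((continuous_apply i).comp hq) ((continuous_apply j).comp hq)

end Lifetime

section OperatorMonotone

open Matrix Unitary

variable {m : Type*} [Fintype m] [DecidableEq m]

theorem cfc_mulVec_of_mulVec_eq_smul {A : Matrix m m ℂ} (hA : A.IsHermitian) (f : ℝ → ℝ)
    {v : m → ℂ} {μ : ℝ} (h : A *ᵥ v = μ • v) : cfc f A *ᵥ v = f μ • v := by
  set U : Matrix m m ℂ := ↑hA.eigenvectorUnitary
  have hU : star U * U = 1 := Unitary.coe_star_mul_self _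
  have hU' : U * star U = 1 := Unitary.coe_mul_star_self _
  have coord (g : ℝ → ℝ) (i : m) :
      (star U *ᵥ (cfc g A *ᵥ v)) i = g (hA.eigenvalues i) * (star U *ᵥ v) i := by
    rw [hA.cfc_eq, IsHermitian.cfc, conjStarAlgAut_apply, mulVec_mulVec, ← mul_assoc, ← mul_assoc,
      hU, one_mul, ← mulVec_mulVec, mulVec_diagonal]
    rfl
  have hμ (i : m) : hA.eigenvalues i = μ ∨ (star U *ᵥ v) i = 0 := by
    have := coord id i
    rw [cfc_id ℝ A hA.isSelfAdjoint, h, mulVec_smul, Pi.smul_apply, Complex.real_smul] at this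
    rcases mul_eq_mul_right_iff.1 this with h | h
    · exact .inl (Complex.ofReal_injective h.symm)
    · exact .inr h
  have key : star U *ᵥ (cfc f A *ᵥ v) = star U *ᵥ (f μ • v) := by
    ext i
    rw [coord, mulVec_smul, Pi.smul_apply, Complex.real_smul]
    rcases hμ i with h | h <;> simp [h]
  simpa [mulVec_mulVec, ← mul_assoc, hU'] using congrArg (U *ᵥ ·) key

theorem cfc_diagonal_ofReal (f : ℝ → ℝ) (p : m → ℝ) :
    cfc f (diagonal fun i => (p i : ℂ)) = diagonal fun i => (f (p i) : ℂ) := by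
  have hp : (diagonal fun i => (p i : ℂ)).IsHermitian :=
    isHermitian_diagonal_of_self_adjoint _ (funext fun _ => Complex.conj_ofReal _)
  refine ext_of_mulVec_single fun j => ?_
  rw [cfc_mulVec_of_mulVec_eq_smul hp f (μ := p j)]
  all_goals
    rw [diagonal_mulVec_single, ← Pi.single_smul]
    simp

theorem OperatorMonotone.monotoneOn {f : ℝ → ℝ} (hf : OperatorMonotone f) :
    MonotoneOn f (Set.Ioi 0) := by
  intro x hx y hy hxy
  have := hf 1 (diagonal fun _ => (x : ℂ)) (diagonal fun _ => (y : ℂ)) (by simpa using hx)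
    (by simpa using hy) (by
      rw [diagonal_sub, posSemidef_diagonal_iff]
      intro _
      rw [← Complex.ofReal_sub, Complex.zero_le_real]
      exact sub_nonneg.2 hxy)
  rw [cfc_diagonal_ofReal f fun _ => y, cfc_diagonal_ofReal f fun _ => x, diagonal_sub,
    posSemidef_diagonal_iff] at this
  simpa [← Complex.ofReal_sub] using this 0

/-- The rank-one perturbation `B = A + ε⁻¹ u u†` with `u = (⟨v, A v⟩ + ε) v - A v` has `v` as an
eigenvector. -/
theorem OperatorMonotone.re_dotProduct_cfc_le {f : ℝ → ℝ} (hf : OperatorMonotone f) {k : ℕ}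
    {A : Matrix (Fin k) (Fin k) ℂ} (hA : A.PosDef) {v : Fin k → ℂ} (hv : star v ⬝ᵥ v = 1) {ε : ℝ}
    (hε : 0 < ε) :
    (star v ⬝ᵥ cfc f A *ᵥ v).re ≤ f ((star v ⬝ᵥ A *ᵥ v).re + ε) := by
  set p := (star v ⬝ᵥ A *ᵥ v).re
  have hpA : star v ⬝ᵥ A *ᵥ v = p := by
    refine Complex.ext rfl ?_
    simpa using hA.1.im_star_dotProduct_mulVec_self v
  set u : Fin k → ℂ := (p + ε) • v - A *ᵥ v with hu
  have huv : star u ⬝ᵥ v = ε := by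
    rw [hu, star_sub, star_mulVec, hA.1, sub_dotProduct, ← dotProduct_mulVec, hpA, star_smul,
      smul_dotProduct, hv]
    simp
  set B := A + ε⁻¹ • vecMulVec u (star u) with hB
  have hR : (ε⁻¹ • vecMulVec u (star u)).PosSemidef :=
    (posSemidef_vecMulVec_self_star u).smul (inv_nonneg.2 hε.le)
  have hBv : B *ᵥ v = (p + ε) • v := by
    rw [hB, add_mulVec, smul_mulVec, vecMulVec_mulVec, huv]
    rw [hu, op_smul_eq_smul, Complex.coe_smul, smul_smul, inv_mul_cancel₀ hε.ne', one_smul,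
      add_sub_cancel]
  have hBpos : B.PosDef := hA.add_posSemidef hR
  have hle := hf k A B hA hBpos (by rwa [hB, add_sub_cancel_left])
  have := hle.re_dotProduct_nonneg v
  rw [sub_mulVec, cfc_mulVec_of_mulVec_eq_smul hBpos.1 f hBv, dotProduct_sub, dotProduct_smul,
    hv] at this
  simpa using this

end OperatorMonotone

section MeanBounds

open Matrix

variable {f : ℝ → ℝ}

theorem OperatorMonotone.add_le_map_add (hf : OperatorMonotone f) {x y a b ε : ℝ} (hx : 0 < x)
    (hy : 0 < y) (ha : 0 ≤ a) (hb : 0 ≤ b) (hab : a + b = 1) (hε : 0 < ε) :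
    a * f x + b * f y ≤ f (a * x + b * y + ε) := by
  have quadForm (z : Fin 2 → ℝ) :
      star ![(√a : ℂ), √b] ⬝ᵥ (diagonal fun i => (z i : ℂ)) *ᵥ ![(√a : ℂ), √b]
        = (a * z 0 + b * z 1 : ℝ) := by
    conv_rhs => rw [← Real.mul_self_sqrt ha, ← Real.mul_self_sqrt hb]
    simp only [dotProduct, Fin.sum_univ_two, Pi.star_apply, mulVec_diagonal, cons_val_zero,
      cons_val_one, cons_val_fin_one, Complex.star_def, Complex.conj_ofReal, Complex.ofReal_add,
      Complex.ofReal_mul]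
    ring
  have hD : (diagonal fun i => (![x, y] i : ℂ)).PosDef := by simp [Fin.forall_fin_two, hx, hy]
  have hv : star ![(√a : ℂ), √b] ⬝ᵥ ![(√a : ℂ), √b] = 1 := by simpa [hab] using quadForm 1
  have := hf.re_dotProduct_cfc_le hD hv hε
  rw [cfc_diagonal_ofReal] at this
  simpa only [quadForm ![x, y], quadForm fun i => f (![x, y] i), Complex.ofReal_re] using! this

namespace IsPetzFunction

theorem map_inv (hf : IsPetzFunction f) {x : ℝ} (hx : 0 < x) : f x⁻¹ = f x / x := by
  rw [hf.symm x hx, mul_div_cancel_left₀ _ hx.ne']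

theorem map_le_self (hf : IsPetzFunction f) {x : ℝ} (hx : 1 ≤ x) : f x ≤ x := by
  have h0 : 0 < x := one_pos.trans_le hx
  have : f x⁻¹ ≤ f 1 := hf.operatorMonotone.monotoneOn (inv_pos.2 h0)
    (Set.mem_Ioi.2 one_pos) (inv_le_one_of_one_le₀ hx)
  rwa [hf.map_inv h0, hf.map_one, div_le_one h0] at this

/-- The weights `1 / (1 + x)` and `x / (1 + x)` make `1` the barycenter of `x` and `x⁻¹`; concavity
of `f` there is the claim, since `f x⁻¹ = f x / x`. -/
theorem le_arithmetic (hf : IsPetzFunction f) {x : ℝ} (hx : 0 < x) : f x ≤ (1 + x) / 2 := by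
  have : 0 < 1 + x := by positivity
  have concave : 1 / (1 + x) * f x + x / (1 + x) * f x⁻¹ ≤ 1 := le_of_forall_pos_le_add fun ε hε =>
    calc _ ≤ f (1 / (1 + x) * x + x / (1 + x) * x⁻¹ + ε) :=
          hf.operatorMonotone.add_le_map_add hx (inv_pos.2 hx) (by positivity) (by positivity)
            (by field_simp) hε
      _ = f (1 + ε) := by congr 1; field_simp; ring
      _ ≤ 1 + ε := hf.map_le_self (by linarith)
  calc f x = (1 / (1 + x) * f x + x / (1 + x) * f x⁻¹) * ((1 + x) / 2) := by
        rw [hf.map_inv hx]; field_simp; norm_num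
    _ ≤ (1 + x) / 2 := mul_le_of_le_one_left (by positivity) concave

end IsPetzFunction

section Inversion

open scoped MatrixOrder Matrix.Norms.L2Operator

variable {m : Type*} [Fintype m] [DecidableEq m]

theorem inv_sub_inv_posSemidef {A B : Matrix m m ℂ} (hA : A.PosDef) (hB : B.PosDef)
    (h : (B - A).PosSemidef) : (A⁻¹ - B⁻¹).PosSemidef := by
  have := CStarAlgebra.inv_le_inv (a := hA.isUnit.unit) (b := hB.isUnit.unit) hA.posSemidef.nonneg h
  simpa [Matrix.le_iff, Matrix.coe_units_inv] using this

theorem posDef_cfc {A : Matrix m m ℂ} (hA : A.PosDef) (hf : ∀ x, 0 < x → 0 < f x) :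
    (cfc f A).PosDef := by
  rw [← Matrix.isStrictlyPositive_iff_posDef] at *
  rw [cfc_isStrictlyPositive_iff f A (A.finite_real_spectrum.continuousOn _)]
  exact fun x hx => hf x (hA.spectrum_pos hx)

theorem cfc_inv_comp_inv {A : Matrix m m ℂ} (hA : A.PosDef) (hf : ∀ x, 0 < x → 0 < f x) :
    cfc (fun x => (f x⁻¹)⁻¹) A = (cfc f A⁻¹)⁻¹ := by
  have hpos : ∀ x ∈ spectrum ℝ A, 0 < x := fun x hx => hA.isStrictlyPositive.spectrum_pos hx
  rw [cfc_inv (fun x => f x⁻¹) A (fun x hx => (hf _ (inv_pos.2 (hpos x hx))).ne')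
    (A.finite_real_spectrum.continuousOn _), ← Matrix.nonsing_inv_eq_ringInverse]
  congr 1
  simpa [Matrix.coe_units_inv] using
    cfc_comp_inv f hA.isUnit.unit ((A.finite_real_spectrum.image _).continuousOn _)

theorem OperatorMonotone.inv_comp_inv (hf : OperatorMonotone f) (hpos : ∀ x, 0 < x → 0 < f x) :
    OperatorMonotone fun x => (f x⁻¹)⁻¹ := by
  intro k A B hA hB hAB
  rw [cfc_inv_comp_inv hA hpos, cfc_inv_comp_inv hB hpos]
  exact inv_sub_inv_posSemidef (posDef_cfc hB.inv hpos) (posDef_cfc hA.inv hpos)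
    (hf k _ _ hB.inv hA.inv (inv_sub_inv_posSemidef hA hB hAB))

end Inversion

/-- `f` lies between the functions `2 x / (1 + x)` and `(1 + x) / 2`, which represent the harmonic
and the arithmetic mean. This makes the first derivatives of `G_f(x, x)` at `ρ` independent of `f`
for `x` commuting with `ρ`. -/
structure HasMeanBounds (f : ℝ → ℝ) : Prop where
  harmonic_le : ∀ x, 0 < x → 2 * x / (1 + x) ≤ f x
  le_arithmetic : ∀ x, 0 < x → f x ≤ (1 + x) / 2

namespace HasMeanBounds

theorem pos (hf : HasMeanBounds f) (x : ℝ) (hx : 0 < x) : 0 < f x :=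
  (by positivity : 0 < 2 * x / (1 + x)).trans_le (hf.harmonic_le x hx)

theorem map_one (hf : HasMeanBounds f) : f 1 = 1 := by
  have h₁ := hf.harmonic_le 1 one_pos
  have h₂ := hf.le_arithmetic 1 one_pos
  norm_num at h₁ h₂
  exact le_antisymm h₂ h₁

end HasMeanBounds

theorem IsPetzFunction.inv_comp_inv (hf : IsPetzFunction f) :
    IsPetzFunction fun x => (f x⁻¹)⁻¹ where
  pos x hx := inv_pos.2 (hf.pos _ (inv_pos.2 hx))
  operatorMonotone := hf.operatorMonotone.inv_comp_inv hf.pos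
  symm x hx := by rw [inv_inv, hf.map_inv hx, inv_div, div_eq_mul_inv]
  map_one := by rw [inv_one, hf.map_one, inv_one]

theorem IsPetzFunction.hasMeanBounds (hf : IsPetzFunction f) : HasMeanBounds f where
  harmonic_le x hx := by
    have h := hf.inv_comp_inv.le_arithmetic (inv_pos.2 hx)
    calc 2 * x / (1 + x) = ((1 + x⁻¹) / 2)⁻¹ := by field_simp; rw [add_comm]
      _ ≤ f x := inv_le_of_inv_le₀ (hf.pos x hx) (by simpa using h)
  le_arithmetic _ := hf.le_arithmetic

end MeanBounds

section Frame

open Matrix Unitary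

variable {m : Type*} [Fintype m] [DecidableEq m]

/-- The star algebra embedding of the real functions on `m` as complex diagonal matrices. -/
def realDiag : (m → ℝ) →⋆ₐ[ℝ] Matrix m m ℂ where
  toFun p := diagonal fun j => (p j : ℂ)
  map_one' := by simp
  map_mul' p q := by simp
  map_zero' := by simp
  map_add' p q := by simp
  commutes' r := by
    simp [Algebra.algebraMap_eq_smul_one, ← diagonal_one, ← diagonal_smul, Pi.smul_def]
  map_star' p := by simp [star_eq_conjTranspose, diagonal_conjTranspose, Pi.star_def]

theorem realDiag_apply (p : m → ℝ) : realDiag p = diagonal fun j => (p j : ℂ) := rfl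

/-- The star algebra embedding `p ↦ U diag(p) U†` of the real functions on `m`. -/
def conjDiag (U : unitary (Matrix m m ℂ)) : (m → ℝ) →⋆ₐ[ℝ] Matrix m m ℂ :=
  (conjStarAlgAut ℝ _ U : Matrix m m ℂ →⋆ₐ[ℝ] Matrix m m ℂ).comp realDiag

theorem single_mul_realDiag (i j : m) (z : ℂ) (p : m → ℝ) :
    single i j z * realDiag p = p j • single i j z := by
  ext k l
  by_cases hk : i = k <;> by_cases hl : j = l <;>
    simp [realDiag_apply, mul_diagonal, single, hk, hl, mul_comm]

theorem realDiag_mul_single (p : m → ℝ) (i j : m) (z : ℂ) :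
    realDiag p * single i j z = p i • single i j z := by
  ext k l
  by_cases hk : i = k <;> by_cases hl : j = l <;>
    simp [realDiag_apply, diagonal_mul, single, hk, hl]

variable (U : unitary (Matrix m m ℂ)) {p : m → ℝ}

theorem conjDiag_apply (p : m → ℝ) : conjDiag U p = conjStarAlgAut ℝ _ U (realDiag p) := rfl

theorem isHermitian_conjDiag (p : m → ℝ) : (conjDiag U p).IsHermitian :=
  IsSelfAdjoint.map (IsSelfAdjoint.all p) (conjDiag U)

theorem commute_conjDiag (p q : m → ℝ) : Commute (conjDiag U p) (conjDiag U q) :=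
  (Commute.all p q).map (conjDiag U)

theorem inv_conjDiag (hp : ∀ j, p j ≠ 0) : (conjDiag U p)⁻¹ = conjDiag U p⁻¹ := by
  refine inv_eq_right_inv ?_
  rw [← map_mul, show p * p⁻¹ = 1 from funext fun j => mul_inv_cancel₀ (hp j), map_one]

theorem posDef_conjDiag_iff : (conjDiag U p).PosDef ↔ ∀ j, 0 < p j := by
  rw [conjDiag_apply, conjStarAlgAut_apply, IsUnit.posDef_star_right_conjugate_iff isUnit_coe,
    realDiag_apply, posDef_diagonal_iff]
  simp

theorem trace_conjStarAlgAut (M : Matrix m m ℂ) : (conjStarAlgAut ℝ _ U M).trace = M.trace := by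
  rw [conjStarAlgAut_apply, trace_mul_cycle, coe_star_mul_self, one_mul]

variable {U} in
theorem isHermitian_conjStarAlgAut_iff {M : Matrix m m ℂ} :
    (conjStarAlgAut ℝ _ U M).IsHermitian ↔ M.IsHermitian := by
  rw [IsHermitian, IsHermitian, ← star_eq_conjTranspose, ← star_eq_conjTranspose, ← map_star]
  exact (EquivLike.injective (conjStarAlgAut ℝ _ U)).eq_iff

theorem exists_eq_conjDiag {ρ : Matrix m m ℂ} (hρ : ρ.PosDef) :
    ∃ (U : unitary (Matrix m m ℂ)) (p : m → ℝ), (∀ j, 0 < p j) ∧ ρ = conjDiag U p :=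
  ⟨hρ.1.eigenvectorUnitary, hρ.1.eigenvalues, hρ.eigenvalues_pos, hρ.1.spectral_theorem⟩

end Frame

section SuperOperator

open Matrix Unitary

variable {n : ℕ}

theorem superFun_apply_of_apply_eq_smul {Φ : SuperOp n} (hΦ : (LinearMap.toMatrix
      (stdBasis ℂ (Fin n) (Fin n)) (stdBasis ℂ (Fin n) (Fin n)) Φ).IsHermitian)
    (f : ℝ → ℝ) {x : Matrix (Fin n) (Fin n) ℂ} {μ : ℝ} (h : Φ x = μ • x) :
    superFun f Φ x = f μ • x := by
  apply (stdBasis ℂ (Fin n) (Fin n)).repr.injective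
  apply DFunLike.coe_injective
  rw [superFun, repr_toLin, cfc_mulVec_of_mulVec_eq_smul hΦ f (μ := μ)]
  · rfl
  · rw [LinearMap.toMatrix_mulVec_repr, h]
    rfl

variable {m R : Type*} [Fintype m] [DecidableEq m] [CommSemiring R] {A B : Matrix m m R}

theorem toMatrix_mulLeft_comp_mulRight (A B : Matrix m m R) :
    LinearMap.toMatrix (stdBasis R m m) (stdBasis R m m)
      (LinearMap.mulLeft R A ∘ₗ LinearMap.mulRight R B) = kroneckerMap (· * ·) A Bᵀ := by
  ext ⟨i, j⟩ ⟨k, l⟩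
  rw [LinearMap.toMatrix_apply, stdBasis_eq_single]
  change (A * ((single k l 1 : Matrix m m R) * B)) i j = A i k * B l j
  simp [single_mul_eq_updateRow_zero, mul_apply, updateRow_apply]

theorem isHermitian_toMatrix_mulLeft_comp_mulRight [StarRing R] (hA : A.IsHermitian)
    (hB : B.IsHermitian) : (LinearMap.toMatrix (stdBasis R m m) (stdBasis R m m)
      (LinearMap.mulLeft R A ∘ₗ LinearMap.mulRight R B)).IsHermitian := by
  rw [toMatrix_mulLeft_comp_mulRight, IsHermitian, conjTranspose_kronecker, hA.eq,
    hB.transpose.eq]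

end SuperOperator

section PetzMean

variable {f : ℝ → ℝ} {x y : ℝ}

/-- The mean represented by `f`. Its values at the pairs of eigenvalues of `ρ` are the eigenvalues
of `K_ρ`. -/
def petzMean (f : ℝ → ℝ) (x y : ℝ) : ℝ := y * f (x / y)

theorem petzMean_pos (hf : ∀ x, 0 < x → 0 < f x) (hx : 0 < x) (hy : 0 < y) : 0 < petzMean f x y :=
  mul_pos hy (hf _ (div_pos hx hy))

theorem petzMean_le_arithmetic (hf : HasMeanBounds f) (hx : 0 < x) (hy : 0 < y) :
    petzMean f x y ≤ (x + y) / 2 :=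
  calc petzMean f x y ≤ y * ((1 + x / y) / 2) :=
        mul_le_mul_of_nonneg_left (hf.le_arithmetic _ (div_pos hx hy)) hy.le
    _ = (x + y) / 2 := by field_simp; ring

theorem inv_petzMean_le (hf : HasMeanBounds f) (hx : 0 < x) (hy : 0 < y) :
    (petzMean f x y)⁻¹ ≤ (x⁻¹ + y⁻¹) / 2 :=
  calc (petzMean f x y)⁻¹ ≤ (y * (2 * (x / y) / (1 + x / y)))⁻¹ :=
        inv_anti₀ (by positivity)
          (mul_le_mul_of_nonneg_left (hf.harmonic_le _ (div_pos hx hy)) hy.le)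
    _ = (x⁻¹ + y⁻¹) / 2 := by field_simp

end PetzMean

section MonotoneMetric

open Matrix Unitary

variable {n : ℕ} {f : ℝ → ℝ} {p : Fin n → ℝ}

variable (U : unitary (Matrix (Fin n) (Fin n) ℂ))

theorem petzK_conj_single (f : ℝ → ℝ) (hp : ∀ j, 0 < p j) (i j : Fin n) (z : ℂ) :
    petzK f (conjDiag U p) (conjStarAlgAut ℝ _ U (single i j z))
      = petzMean f (p i) (p j) • conjStarAlgAut ℝ _ U (single i j z) := by
  set x := conjStarAlgAut ℝ _ U (single i j z) with hx
  have hL (q : Fin n → ℝ) : conjDiag U q * x = q i • x := by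
    rw [conjDiag_apply, hx, ← map_mul, realDiag_mul_single, map_smul]
  have hR (q : Fin n → ℝ) : x * conjDiag U q = q j • x := by
    rw [conjDiag_apply, hx, ← map_mul, single_mul_realDiag, map_smul]
  have hinv := inv_conjDiag U fun j => (hp j).ne'
  have hLR : (LinearMap.mulLeft ℂ (conjDiag U p) ∘ₗ LinearMap.mulRight ℂ (conjDiag U p)⁻¹) x
      = (p i / p j) • x := by
    rw [hinv, LinearMap.comp_apply, LinearMap.mulRight_apply, LinearMap.mulLeft_apply, hR,
      mul_smul_comm, hL, smul_smul, Pi.inv_apply, div_eq_inv_mul]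
  have hherm := isHermitian_toMatrix_mulLeft_comp_mulRight (isHermitian_conjDiag U p)
    (hinv ▸ isHermitian_conjDiag U p⁻¹ : (conjDiag U p)⁻¹.IsHermitian)
  rw [petzK, LinearMap.comp_apply, LinearMap.mulRight_apply, hR,
    LinearMap.map_smul_of_tower, superFun_apply_of_apply_eq_smul hherm f hLR, smul_smul, petzMean]

theorem petzK_conj (f : ℝ → ℝ) (hp : ∀ j, 0 < p j) (M : Matrix (Fin n) (Fin n) ℂ) :
    petzK f (conjDiag U p) (conjStarAlgAut ℝ _ U M)
      = conjStarAlgAut ℝ _ U (of fun i j => petzMean f (p i) (p j) • M i j) := by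
  conv_lhs => rw [matrix_eq_sum_single M]
  conv_rhs => rw [matrix_eq_sum_single (of _)]
  simp only [map_sum, petzK_conj_single U f hp, of_apply, ← smul_single, map_smul]

theorem isUnit_petzK (hf : ∀ x, 0 < x → 0 < f x) {ρ : Matrix (Fin n) (Fin n) ℂ} (hρ : ρ.PosDef) :
    IsUnit (petzK f ρ) := by
  obtain ⟨U, p, hp, rfl⟩ := exists_eq_conjDiag hρ
  rw [LinearMap.isUnit_iff_ker_eq_bot, LinearMap.ker_eq_bot']
  intro x hx
  obtain ⟨M, rfl⟩ := EquivLike.surjective (conjStarAlgAut ℝ _ U) x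
  rw [petzK_conj U f hp, map_eq_zero_iff _ (EquivLike.injective (conjStarAlgAut ℝ _ U))] at hx
  suffices M = 0 by rw [this, map_zero]
  ext i j
  simpa [(petzMean_pos hf (hp i) (hp j)).ne'] using congrFun₂ hx i j

theorem ringInverse_petzK_conj (hf : ∀ x, 0 < x → 0 < f x) (hp : ∀ j, 0 < p j)
    (M : Matrix (Fin n) (Fin n) ℂ) :
    Ring.inverse (petzK f (conjDiag U p)) (conjStarAlgAut ℝ _ U M)
      = conjStarAlgAut ℝ _ U (of fun i j => (petzMean f (p i) (p j))⁻¹ • M i j) := by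
  have hM : conjStarAlgAut ℝ _ U M = petzK f (conjDiag U p)
      (conjStarAlgAut ℝ _ U (of fun i j => (petzMean f (p i) (p j))⁻¹ • M i j)) := by
    rw [petzK_conj U f hp]
    congr 1
    ext i j
    simp only [of_apply, smul_inv_smul₀ (petzMean_pos hf (hp i) (hp j)).ne']
  rw [hM, ← Module.End.mul_apply,
    Ring.inverse_mul_cancel _ (isUnit_petzK hf ((posDef_conjDiag_iff U).2 hp))]
  rfl

theorem monotoneMetric_conj (hf : ∀ x, 0 < x → 0 < f x) (hp : ∀ j, 0 < p j)
    (V W : Matrix (Fin n) (Fin n) ℂ) :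
    monotoneMetric f (conjDiag U p) (conjStarAlgAut ℝ _ U V) (conjStarAlgAut ℝ _ U W)
      = ∑ i, ∑ j, (petzMean f (p i) (p j))⁻¹ * (star (V i j) * W i j).re := by
  rw [monotoneMetric, ringInverse_petzK_conj U hf hp, ← star_eq_conjTranspose, ← map_star,
    ← map_mul, trace_conjStarAlgAut, trace_mul_comm]
  simp only [trace, diag, mul_apply, Complex.re_sum, star_apply, of_apply]
  refine Finset.sum_congr rfl fun i _ => Finset.sum_congr rfl fun j _ => ?_
  rw [smul_mul_assoc, Complex.smul_re, smul_eq_mul, mul_comm (W i j)]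

theorem monotoneMetric_conjDiag (hf : ∀ x, 0 < x → 0 < f x) (hf₁ : f 1 = 1) (hp : ∀ j, 0 < p j)
    (ξ : Fin n → ℝ) (W : Matrix (Fin n) (Fin n) ℂ) :
    monotoneMetric f (conjDiag U p) (conjDiag U ξ) (conjStarAlgAut ℝ _ U W)
      = fisherRao p ξ fun j => (W j j).re := by
  rw [conjDiag_apply U ξ, monotoneMetric_conj U hf hp, fisherRao]
  refine Finset.sum_congr rfl fun i _ => ?_
  rw [Finset.sum_eq_single i]
  · simp [realDiag_apply, petzMean, (hp i).ne', hf₁, div_eq_inv_mul]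
  · intro j _ hj
    simp [realDiag_apply, hj.symm]
  · simp

end MonotoneMetric

section Comparison

open Matrix Unitary

variable {m : Type*} [Fintype m]

theorem re_trace_mul_eq_sum (y : Matrix m m ℂ) {x : Matrix m m ℂ} (hx : x.IsHermitian) :
    (y * x).trace.re = ∑ i, ∑ j, (star (x i j) * y i j).re := by
  simp only [trace, diag, mul_apply, Complex.re_sum, mul_comm (y _ _), hx.apply]

theorem re_trace_realDiag_mul_mul_self [DecidableEq m] (q : m → ℝ) {x : Matrix m m ℂ}
    (hx : x.IsHermitian) :
    (realDiag q * (x * x)).trace.re = ∑ i, ∑ j, (q i + q j) / 2 * Complex.normSq (x i j) := by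
  have hsum : (realDiag q * (x * x)).trace.re = ∑ i, ∑ j, q i * Complex.normSq (x i j) := by
    rw [← mul_assoc, re_trace_mul_eq_sum _ hx]
    refine Finset.sum_congr rfl fun i _ => Finset.sum_congr rfl fun j _ => ?_
    rw [realDiag_apply, diagonal_mul, Complex.star_def, mul_left_comm, Complex.re_ofReal_mul,
      ← Complex.normSq_eq_conj_mul_self, Complex.ofReal_re]
  have hswap : ∑ i, ∑ j, q i * Complex.normSq (x i j)
      = ∑ i, ∑ j, q j * Complex.normSq (x i j) := by
    rw [Finset.sum_comm]
    refine Finset.sum_congr rfl fun i _ => Finset.sum_congr rfl fun j _ => ?_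
    rw [← hx.apply, Complex.star_def, Complex.normSq_conj]
  simp only [add_div, add_mul, Finset.sum_add_distrib, div_mul_eq_mul_div, ← Finset.sum_div,
    ← hswap, hsum, add_halves]

theorem two_mul_re_sub_le {c : ℝ} (hc : 0 < c) (z w : ℂ) :
    2 * (star z * w).re - c * Complex.normSq w ≤ c⁻¹ * Complex.normSq z := by
  have hsq : 0 ≤ c⁻¹ * Complex.normSq (z - c * w) :=
    mul_nonneg (inv_nonneg.2 hc.le) (Complex.normSq_nonneg _)
  have hexpand : c⁻¹ * Complex.normSq (z - c * w)
      = c⁻¹ * Complex.normSq z - 2 * (star z * w).re + c * Complex.normSq w := by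
    simp only [Complex.normSq_apply, Complex.star_def, Complex.sub_re, Complex.sub_im,
      Complex.mul_re, Complex.mul_im, Complex.conj_re, Complex.conj_im, Complex.ofReal_re,
      Complex.ofReal_im]
    field_simp
    ring
  linarith

variable {n : ℕ} {f : ℝ → ℝ} {ρ x y : Matrix (Fin n) (Fin n) ℂ}

theorem monotoneMetric_conj_self (hf : ∀ x, 0 < x → 0 < f x)
    (U : unitary (Matrix (Fin n) (Fin n) ℂ)) {p : Fin n → ℝ} (hp : ∀ j, 0 < p j)
    (V : Matrix (Fin n) (Fin n) ℂ) :
    monotoneMetric f (conjDiag U p) (conjStarAlgAut ℝ _ U V) (conjStarAlgAut ℝ _ U V)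
      = ∑ i, ∑ j, (petzMean f (p i) (p j))⁻¹ * Complex.normSq (V i j) := by
  simp only [monotoneMetric_conj U hf hp, Complex.star_def, ← Complex.normSq_eq_conj_mul_self,
    Complex.ofReal_re]

theorem monotoneMetric_self_le (hf : HasMeanBounds f) (hρ : ρ.PosDef) (hx : x.IsHermitian) :
    monotoneMetric f ρ x x ≤ (ρ⁻¹ * (x * x)).trace.re := by
  obtain ⟨U, p, hp, rfl⟩ := exists_eq_conjDiag hρ
  obtain ⟨X, rfl⟩ := EquivLike.surjective (conjStarAlgAut ℝ _ U) x
  rw [inv_conjDiag U fun j => (hp j).ne', conjDiag_apply U p⁻¹, ← map_mul, ← map_mul,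
    trace_conjStarAlgAut, re_trace_realDiag_mul_mul_self _ (isHermitian_conjStarAlgAut_iff.1 hx),
    monotoneMetric_conj_self hf.pos U hp]
  gcongr with i _ j _
  exacts [Complex.normSq_nonneg _, inv_petzMean_le hf (hp i) (hp j)]

theorem le_monotoneMetric_self (hf : HasMeanBounds f) (hρ : ρ.PosDef) (hx : x.IsHermitian)
    (hy : y.IsHermitian) :
    2 * (y * x).trace.re - (ρ * (y * y)).trace.re ≤ monotoneMetric f ρ x x := by
  obtain ⟨U, p, hp, rfl⟩ := exists_eq_conjDiag hρ
  obtain ⟨X, rfl⟩ := EquivLike.surjective (conjStarAlgAut ℝ _ U) x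
  obtain ⟨Y, rfl⟩ := EquivLike.surjective (conjStarAlgAut ℝ _ U) y
  rw [isHermitian_conjStarAlgAut_iff] at hx hy
  rw [conjDiag_apply, ← map_mul, ← map_mul, ← map_mul, trace_conjStarAlgAut, trace_conjStarAlgAut,
    re_trace_mul_eq_sum _ hx, re_trace_realDiag_mul_mul_self _ hy, ← conjDiag_apply,
    monotoneMetric_conj_self hf.pos U hp]
  simp only [Finset.mul_sum, ← Finset.sum_sub_distrib]
  refine Finset.sum_le_sum fun i _ => Finset.sum_le_sum fun j _ => ?_
  refine le_trans ?_ (two_mul_re_sub_le (petzMean_pos hf.pos (hp i) (hp j)) (X i j) (Y i j))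
  gcongr
  exacts [Complex.normSq_nonneg _, petzMean_le_arithmetic hf (hp i) (hp j)]

end Comparison

section TransverseDerivative

open Matrix Filter Topology Asymptotics

theorem hasDerivAt_of_squeeze {l q u : ℝ → ℝ} {d t : ℝ} (hl : HasDerivAt l d t)
    (hu : HasDerivAt u d t) (hlu : l t = u t) (hlq : ∀ᶠ s in 𝓝 t, l s ≤ q s)
    (hqu : ∀ᶠ s in 𝓝 t, q s ≤ u s) : HasDerivAt q d t := by
  have hlt : l t = q t := le_antisymm hlq.self_of_nhds (hlu ▸ hqu.self_of_nhds)
  have hgap : (fun s => u s - l s) =o[𝓝 t] fun s => s - t := by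
    simpa [hlu] using (hu.sub hl).isLittleO
  have hdiff : (fun s => q s - l s) =o[𝓝 t] fun s => s - t := by
    refine (IsBigO.of_bound 1 ?_).trans_isLittleO hgap
    filter_upwards [hlq, hqu] with s hl hu
    rw [Real.norm_of_nonneg (sub_nonneg.2 hl), Real.norm_of_nonneg (sub_nonneg.2 (hl.trans hu)),
      one_mul]
    exact sub_le_sub_right hu _
  refine .of_isLittleO ((hl.isLittleO.add hdiff).congr_left fun s => ?_)
  rw [hlt]
  ring

open scoped MatrixOrder Matrix.Norms.L2Operator in
theorem eventually_posDef_add_smul {m : Type*} [Finite m] {ρ w : Matrix m m ℂ}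
    (hρ : ρ.PosDef) (hw : w.IsHermitian) : ∀ᶠ s in 𝓝 (0 : ℝ), (ρ + s • w).PosDef := by
  have := Fintype.ofFinite m
  classical
  cases subsingleton_or_nontrivial (Matrix m m ℂ)
  · exact .of_forall fun s => Subsingleton.elim ρ (ρ + s • w) ▸ hρ
  obtain ⟨r, hr, hrρ⟩ := (CFC.exists_pos_algebraMap_le_iff hρ.1.isSelfAdjoint).2
    fun x hx => hρ.isStrictlyPositive.spectrum_pos hx
  have hsmall : ∀ᶠ s : ℝ in 𝓝 0, ‖s • w‖ < r :=
    (continuous_id.smul continuous_const).norm.tendsto' 0 0 (by simp) |>.eventually_lt_const hr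
  filter_upwards [hsmall] with s hs
  have hsw : IsSelfAdjoint (s • w) := IsSelfAdjoint.smul (IsSelfAdjoint.all s) hw.isSelfAdjoint
  have hle : algebraMap ℝ _ (r - ‖s • w‖) ≤ ρ + s • w := by
    rw [map_sub, sub_eq_add_neg]
    exact add_le_add hrρ hsw.neg_algebraMap_norm_le_self
  exact isStrictlyPositive_iff_posDef.1 ((isStrictlyPositive_algebraMap (sub_pos.2 hs)).of_le hle)

variable {m : Type*} [Fintype m]

theorem hasDerivAt_re_trace_add_smul_mul (ρ w y : Matrix m m ℂ) (c : ℝ) :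
    HasDerivAt (fun s : ℝ => c - ((ρ + s • w) * y).trace.re) (-(w * y).trace.re) 0 := by
  have haffine (s : ℝ) : c - ((ρ + s • w) * y).trace.re
      = c - (ρ * y).trace.re - s * (w * y).trace.re := by
    simp [add_mul, sub_sub]
  simpa [haffine] using
    ((hasDerivAt_id (0 : ℝ)).mul_const (w * y).trace.re).const_sub (c - (ρ * y).trace.re)

variable [DecidableEq m] {ρ : Matrix m m ℂ}

open scoped Matrix.Norms.L2Operator in
theorem hasDerivAt_inv_add_smul (hρ : IsUnit ρ) (w : Matrix m m ℂ) :
    HasDerivAt (fun s : ℝ => (ρ + s • w)⁻¹) (-(ρ⁻¹ * w * ρ⁻¹)) 0 := by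
  have hline : HasDerivAt (fun s : ℝ => ρ + s • w) w 0 := by
    simpa using ((hasDerivAt_id (0 : ℝ)).smul_const w).const_add ρ
  have hinv := (hasFDerivAt_ringInverse (𝕜 := ℝ) hρ.unit).comp_hasDerivAt_of_eq (0 : ℝ) hline
    (by simp)
  simpa [nonsing_inv_eq_ringInverse, Function.comp_def] using hinv

open scoped Matrix.Norms.L2Operator in
theorem hasDerivAt_re_trace_inv_add_smul_mul (hρ : IsUnit ρ) (w y : Matrix m m ℂ) :
    HasDerivAt (fun s : ℝ => ((ρ + s • w)⁻¹ * y).trace.re) (-(ρ⁻¹ * w * ρ⁻¹ * y).trace.re) 0 := by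
  have h := (Complex.reLm ∘ₗ traceLinearMap m ℝ ℂ).toContinuousLinearMap.hasFDerivAt
    |>.comp_hasDerivAt (0 : ℝ) ((hasDerivAt_inv_add_smul hρ w).mul_const y)
  simpa using! h

variable {n : ℕ} {f : ℝ → ℝ} {ρ x w : Matrix (Fin n) (Fin n) ℂ}

/-- For `x` commuting with `ρ`, the lower bound with `y = ρ⁻¹ x` and the upper bound for `G_f(x, x)`
agree at `ρ` to first order, so they determine the derivative whatever `f` is. -/
theorem hasDerivAt_alongLine_monotoneMetric (hf : HasMeanBounds f) (hρ : ρ.PosDef)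
    (hx : x.IsHermitian) (hw : w.IsHermitian) (hxρ : Commute x ρ) :
    HasDerivAt (alongLine (monotoneMetric f) ρ w x x)
      (-(ρ⁻¹ * w * ρ⁻¹ * (x * x)).trace.re) 0 := by
  have hdet : IsUnit ρ.det := (isUnit_iff_isUnit_det ρ).1 hρ.isUnit
  have hcomm : Commute x ρ⁻¹ := by simpa using Matrix.Commute.zpow_right hxρ (-1)
  have hy : (ρ⁻¹ * x).IsHermitian := (hρ.inv.1.commute_iff hx).1 hcomm.symm
  have hyy : ρ⁻¹ * x * (ρ⁻¹ * x) = ρ⁻¹ * (x * x) * ρ⁻¹ := by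
    calc ρ⁻¹ * x * (ρ⁻¹ * x) = ρ⁻¹ * x * (x * ρ⁻¹) := by rw [hcomm.eq]
      _ = ρ⁻¹ * (x * x) * ρ⁻¹ := by simp only [mul_assoc]
  have hlower : HasDerivAt (fun s : ℝ => 2 * (ρ⁻¹ * x * x).trace.re
      - ((ρ + s • w) * (ρ⁻¹ * x * (ρ⁻¹ * x))).trace.re)
      (-(ρ⁻¹ * w * ρ⁻¹ * (x * x)).trace.re) 0 := by
    refine (hasDerivAt_re_trace_add_smul_mul ρ w _ _).congr_deriv ?_
    rw [hyy, ← mul_assoc, ← trace_mul_comm ρ⁻¹, ← mul_assoc, ← mul_assoc]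
  have htouch : 2 * (ρ⁻¹ * x * x).trace.re - (ρ * (ρ⁻¹ * x * (ρ⁻¹ * x))).trace.re
      = (ρ⁻¹ * (x * x)).trace.re := by
    rw [hyy, mul_assoc ρ⁻¹ (x * x), mul_nonsing_inv_cancel_left ρ _ hdet, trace_mul_comm (x * x),
      mul_assoc]
    ring
  have hpos := eventually_posDef_add_smul hρ hw
  exact hasDerivAt_of_squeeze hlower (hasDerivAt_re_trace_inv_add_smul_mul hρ.isUnit w _)
    (by simpa using htouch)
    (hpos.mono fun s hs => le_monotoneMetric_self hf hs hx hy)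
    (hpos.mono fun s hs => monotoneMetric_self_le hf hs hx)

end TransverseDerivative

section Universality

open Matrix Unitary Filter Topology

variable {n : ℕ} {f : ℝ → ℝ} {p : Fin n → ℝ} (U : unitary (Matrix (Fin n) (Fin n) ℂ))

theorem conjDiag_mem_nondegenerateStates (hp : p ∈ simplex n) (hinj : Function.Injective p) :
    conjDiag U p ∈ nondegenerateStates n := by
  refine ⟨(posDef_conjDiag_iff U).2 hp.1, ?_, ?_⟩
  · rw [conjDiag_apply, trace_conjStarAlgAut, realDiag_apply, trace_diagonal]
    exact_mod_cast hp.2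
  · have hchar : (conjDiag U p).charpoly = (realDiag p).charpoly := by
      rw [conjDiag_apply, conjStarAlgAut_apply, charpoly_mul_comm, ← mul_assoc, coe_star_mul_self,
        one_mul]
    rw [hchar, realDiag_apply, charpoly_diagonal, Polynomial.roots_prod _ _
      (Finset.prod_ne_zero_iff.2 fun i _ => Polynomial.X_sub_C_ne_zero _)]
    simp only [Polynomial.roots_X_sub_C, Multiset.bind_singleton]
    exact Finset.univ.nodup.map (Complex.ofReal_injective.comp hinj)

theorem diag_re_mem_simplexTangent {W : Matrix (Fin n) (Fin n) ℂ} (hW : W.trace = 0) :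
    (fun j => (W j j).re) ∈ simplexTangent n := by
  simpa [trace, simplexTangent] using congrArg Complex.re hW

theorem hasDerivAt_alongLine_conjDiag_tangential (hf : ∀ x, 0 < x → 0 < f x) (hf₁ : f 1 = 1)
    (hp : ∀ j, 0 < p j) (ξ : Fin n → ℝ) (W : Matrix (Fin n) (Fin n) ℂ) :
    HasDerivAt (alongLine (monotoneMetric f) (conjDiag U p) (conjDiag U ξ) (conjDiag U ξ)
      (conjStarAlgAut ℝ _ U W)) (-∑ j, ξ j * ξ j * (W j j).re / p j ^ 2) 0 := by
  refine (hasDerivAt_alongLine_fisherRao (fun j => (hp j).ne') ξ ξ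
    fun j => (W j j).re).congr_of_eventuallyEq ?_
  have hpos : ∀ᶠ s in 𝓝 (0 : ℝ), ∀ j, 0 < (p + s • ξ) j := by
    refine eventually_all.2 fun j => ?_
    have hline : Continuous fun s : ℝ => (p + s • ξ) j := by fun_prop
    exact hline.continuousAt.eventually_const_lt (by simpa using hp j)
  filter_upwards [hpos] with s hs
  rw [alongLine, alongLine, ← map_smul, ← map_add, monotoneMetric_conjDiag U hf hf₁ hs]

theorem hasDerivAt_alongLine_conjDiag_transverse (hf : HasMeanBounds f) (hp : ∀ j, 0 < p j)
    (ξ : Fin n → ℝ) {W : Matrix (Fin n) (Fin n) ℂ} (hW : W.IsHermitian) :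
    HasDerivAt (alongLine (monotoneMetric f) (conjDiag U p) (conjStarAlgAut ℝ _ U W)
      (conjDiag U ξ) (conjDiag U ξ)) (-∑ j, (W j j).re * ξ j * ξ j / p j ^ 2) 0 := by
  refine (hasDerivAt_alongLine_monotoneMetric hf ((posDef_conjDiag_iff U).2 hp)
    (isHermitian_conjDiag U ξ) (isHermitian_conjStarAlgAut_iff.2 hW)
    (commute_conjDiag U ξ p)).congr_deriv ?_
  rw [inv_conjDiag U fun j => (hp j).ne', conjDiag_apply, conjDiag_apply, ← map_mul, ← map_mul,
    ← map_mul, ← map_mul, trace_conjStarAlgAut, ← map_mul, trace, Complex.re_sum]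
  refine congrArg Neg.neg (Finset.sum_congr rfl fun j _ => ?_)
  simp only [realDiag_apply, diag_apply, mul_diagonal, diagonal_mul, Complex.re_mul_ofReal,
    Complex.re_ofReal_mul, Pi.mul_apply, Pi.inv_apply]
  field_simp

theorem monotoneMetric_add_christoffel (hf : HasMeanBounds f) (hp : ∀ j, 0 < p j)
    (u ξ : Fin n → ℝ) {W : Matrix (Fin n) (Fin n) ℂ} (hW : W.IsHermitian) :
    monotoneMetric f (conjDiag U p) (conjDiag U u) (conjStarAlgAut ℝ _ U W)
      + christoffel (monotoneMetric f) (conjDiag U p) (conjDiag U ξ) (conjDiag U ξ)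
        (conjStarAlgAut ℝ _ U W)
      = fisherRao p (covariantAccel p ξ u) fun j => (W j j).re := by
  rw [← fisherRao_add_christoffel fun j => (hp j).ne',
    monotoneMetric_conjDiag U hf.pos hf.map_one hp]
  simp only [christoffel, metricDeriv,
    (hasDerivAt_alongLine_conjDiag_tangential U hf.pos hf.map_one hp ξ W).deriv,
    (hasDerivAt_alongLine_conjDiag_transverse U hf hp ξ hW).deriv,
    (hasDerivAt_alongLine_fisherRao (fun j => (hp j).ne') _ _ _).deriv]

open scoped Matrix.Norms.L2Operator in
theorem hasDerivAt_conjDiag_comp {q : ℝ → Fin n → ℝ} {q' : Fin n → ℝ} {t : ℝ}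
    (hq : HasDerivAt q q' t) : HasDerivAt (fun s => conjDiag U (q s)) (conjDiag U q') t :=
  (LinearMap.toContinuousLinearMap
    (conjDiag U).toAlgHom.toLinearMap).hasFDerivAt.comp_hasDerivAt t hq

open scoped Matrix.Norms.L2Operator in
theorem deriv_conjDiag_comp {q : ℝ → Fin n → ℝ} {t : ℝ} (hq : DifferentiableAt ℝ q t) :
    deriv (fun s => conjDiag U (q s)) t = conjDiag U (deriv q t) :=
  (hasDerivAt_conjDiag_comp U hq.hasDerivAt).deriv

open scoped Matrix.Norms.L2Operator in
theorem hasDerivAt_deriv_conjDiag_comp {q : ℝ → Fin n → ℝ} {q'' : Fin n → ℝ} {t : ℝ}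
    (hq : ∀ᶠ s in 𝓝 t, DifferentiableAt ℝ q s) (hq' : HasDerivAt (deriv q) q'' t) :
    HasDerivAt (deriv fun s => conjDiag U (q s)) (conjDiag U q'') t :=
  (hasDerivAt_conjDiag_comp U hq').congr_of_eventuallyEq
    (hq.mono fun _ => deriv_conjDiag_comp U)

open scoped Matrix.Norms.L2Operator in
theorem deriv_deriv_conjDiag_comp {q : ℝ → Fin n → ℝ} {t : ℝ}
    (hq : ∀ᶠ s in 𝓝 t, DifferentiableAt ℝ q s) (hq' : DifferentiableAt ℝ (deriv q) t) :
    deriv (deriv fun s => conjDiag U (q s)) t = conjDiag U (deriv (deriv q) t) :=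
  (hasDerivAt_deriv_conjDiag_comp U hq hq'.hasDerivAt).deriv

theorem isGeodesicOn_conjDiag (hf : HasMeanBounds f) {I : Set ℝ} {q : ℝ → Fin n → ℝ}
    (hI : IsOpen I) (hq : IsGeodesicOn (simplex n) (simplexTangent n) fisherRao I q)
    (hinj : ∀ t ∈ I, Function.Injective (q t)) :
    IsGeodesicOn (nondegenerateStates n) (stateTangent n) (monotoneMetric f) I
      fun t => conjDiag U (q t) := by
  have hd' (t) (ht : t ∈ I) : ∀ᶠ s in 𝓝 t, DifferentiableAt ℝ q s :=
    eventually_of_mem (hI.mem_nhds ht) fun _ => hq.differentiableAt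
  refine ⟨fun t ht => ⟨conjDiag_mem_nondegenerateStates U (hq.mem ht) (hinj t ht),
    ⟨_, hasDerivAt_conjDiag_comp U (hq.differentiableAt ht).hasDerivAt⟩,
    ⟨_, hasDerivAt_deriv_conjDiag_comp U (hd' t ht) (hq.differentiableAt_deriv ht).hasDerivAt⟩⟩,
    fun t ht w hw => ?_⟩
  have hp := (hq.mem ht).1
  obtain ⟨W, rfl⟩ := EquivLike.surjective (conjStarAlgAut ℝ _ U) w
  have hW : W.IsHermitian := isHermitian_conjStarAlgAut_iff.1 hw.1
  rw [deriv_deriv_conjDiag_comp U (hd' t ht) (hq.differentiableAt_deriv ht),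
    deriv_conjDiag_comp U (hq.differentiableAt ht)]
  refine ⟨⟨_, hasDerivAt_alongLine_conjDiag_tangential U hf.pos hf.map_one hp _ W⟩,
    ⟨_, hasDerivAt_alongLine_conjDiag_transverse U hf hp _ hW⟩, ?_⟩
  rw [monotoneMetric_add_christoffel U hf hp _ _ hW]
  exact (forall_fisherRao_eq_zero_iff (hq.mem ht)).2
    ((isGeodesicOn_simplex_iff.1 hq).2 t ht) _
    (diag_re_mem_simplexTangent ((trace_conjStarAlgAut U W).symm.trans hw.2))

end Universality

end UniversalGeodesics

end

open UniversalGeodesics in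
theorem mainTheorem3_general (n : ℕ) :
    (∀ p ∈ simplex n, ∀ a ∈ simplexTangent n,
      let c := frCurve p a
      let J := lifetime (simplex n) c
      (IsOpen J ∧ 0 ∈ J ∧ c 0 = p ∧ deriv c 0 = a ∧
        IsGeodesicOn (simplex n) (simplexTangent n) fisherRao J c) ∧
      ∀ (I : Set ℝ) (q : ℝ → Fin n → ℝ), IsOpen I → I.OrdConnected → 0 ∈ I →
        IsGeodesicOn (simplex n) (simplexTangent n) fisherRao I q →
        q 0 = p → deriv q 0 = a → I ⊆ J ∧ ∀ t ∈ I, q t = c t) ∧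
    (∀ p ∈ weylChamber n, ∀ a ∈ simplexTangent n, ∀ U : Matrix.unitaryGroup (Fin n) ℂ,
      let c := frCurve p a
      let J := lifetime (weylChamber n) c
      IsOpen J ∧ 0 ∈ J ∧
      ∀ f : ℝ → ℝ, HasMeanBounds f →
        IsGeodesicOn (nondegenerateStates n) (stateTangent n) (monotoneMetric f) J
          (fun t => conjDiag U (c t))) := by
  refine ⟨fun p hp a ha => ⟨⟨?_, ?_, ?_, ?_, ?_⟩, ?_⟩, fun p hp a ha U => ?_⟩
  · exact isOpen_lifetime (isOpen_preimage_simplex (continuous_frCurve hp.1 a) (sum_frCurve hp ha))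
  · exact zero_mem_lifetime (by rwa [frCurve_zero])
  · exact frCurve_zero p a
  · exact (hasDerivAt_frCurve hp.1 a 0).deriv.trans (frVelocity_zero hp.1 a)
  · exact isGeodesicOn_frCurve hp.1 (mapsTo_lifetime _ _)
  · rintro I q hI hI' h0 hq rfl rfl
    have heq (t) (ht : t ∈ I) := hq.eq_frCurve hI hI'.isPreconnected h0 ht
    exact ⟨subset_lifetime hI'.isPreconnected h0 fun t ht => heq t ht ▸ hq.mem ht, heq⟩
  · have hmem := mapsTo_lifetime (weylChamber n) (frCurve p a)
    have hopen := isOpen_lifetime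
      (isOpen_preimage_weylChamber (continuous_frCurve hp.1.1 a) (sum_frCurve hp.1 ha))
    have hgeo := isGeodesicOn_frCurve hp.1.1 fun _ ht => (hmem ht).1
    exact ⟨hopen, zero_mem_lifetime (by rwa [frCurve_zero]), fun f hf =>
      isGeodesicOn_conjDiag U hf hopen hgeo fun _ ht => (hmem ht).2.injective⟩

theorem mainTheorem3 (n : ℕ) :
    -- the Fisher-Rao geodesics of the open simplex are given by the explicit formula
    (∀ p ∈ UniversalGeodesics.simplex n, ∀ a ∈ UniversalGeodesics.simplexTangent n,
      let c := UniversalGeodesics.frCurve p a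
      let J := UniversalGeodesics.lifetime (UniversalGeodesics.simplex n) c
      (IsOpen J ∧ 0 ∈ J ∧ c 0 = p ∧ deriv c 0 = a ∧
        UniversalGeodesics.IsGeodesicOn (UniversalGeodesics.simplex n)
          (UniversalGeodesics.simplexTangent n) UniversalGeodesics.fisherRao J c) ∧
      ∀ (I : Set ℝ) (q : ℝ → Fin n → ℝ), IsOpen I → I.OrdConnected → 0 ∈ I →
        UniversalGeodesics.IsGeodesicOn (UniversalGeodesics.simplex n)
          (UniversalGeodesics.simplexTangent n) UniversalGeodesics.fisherRao I q →
        q 0 = p → deriv q 0 = a → I ⊆ J ∧ ∀ t ∈ I, q t = c t) ∧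
    -- conjugated with a fixed unitary, they are geodesics of every monotone metric
    (∀ p ∈ UniversalGeodesics.weylChamber n, ∀ a ∈ UniversalGeodesics.simplexTangent n,
      ∀ U : Matrix.specialUnitaryGroup (Fin n) ℂ,
      let c := UniversalGeodesics.frCurve p a
      let J := UniversalGeodesics.lifetime (UniversalGeodesics.weylChamber n) c
      IsOpen J ∧ 0 ∈ J ∧
      ∀ f : ℝ → ℝ, UniversalGeodesics.IsPetzFunction f →
        UniversalGeodesics.IsGeodesicOn (UniversalGeodesics.nondegenerateStates n)
          (UniversalGeodesics.stateTangent n) (UniversalGeodesics.monotoneMetric f) J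
          (fun t => UniversalGeodesics.unfolding U (c t))) := by
  refine ⟨(mainTheorem3_general n).1, fun p hp a ha U => ?_⟩
  have h := (mainTheorem3_general n).2 p hp a ha
    ⟨U, (Matrix.mem_specialUnitaryGroup_iff.1 U.2).1⟩
  exact ⟨h.1, h.2.1, fun f hf => h.2.2 f hf.hasMeanBounds⟩
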